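/- \textbf{Theorem (Hyers--Ulam stability).} Let $\mathbb{T}\subseteq\mathbb{R}$ be a time scale (a nonempty closed set) with forward jump operator $\sigma$ ($\sigma(t)=\inf\{s\in\mathbb{T}: s>t\}$, and $\sigma(t)=t$ if $t=\max\mathbb{T}$) and graininess $\mu(t)=\sigma(t)-t$; write $[a,b]_{\mathbb{T}}=[a,b]\cap\mathbb{T}$. Let $n\ge 1$ and let $a\le b$ and $d\ge\sigma^n(b)$ be points of $\mathbb{T}$. All functions are real-valued functions on $E=[a,d]_{\mathbb{T}}$ (for instance with $d=\sigma^n(b)$), and $y^\Delta(t)$ is the delta derivative on $E$: the number $D$ such that for every $\eta>0$ one has $|y(\sigma(t))-y(s)-D(\sigma(t)-s)|\le\eta|\sigma(t)-s|$ for all $s\in E$ near $t$. Assume that $\sigma^{n-1}(b)<d$ or that $\sigma^{n-1}(b)=d$ is a limit of points of $E$ from the left, so that the delta derivatives below are unique. A function on an interval of $\mathbb{T}$ is rd-continuous ($C_{rd}$) if it is continuous at the points with $\sigma(t)=t$ and has finite left-sided limits at left-dense points; it is $C^1_{rd}$ on an interval if it is delta differentiable at each point of it with a derivative that is rd-continuous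 on it. Let $\varphi,f\in C_{rd}(E)$, let $\alpha_0,\dots,\alpha_n\in\mathbb{R}$ with $\alpha_n=1$, and consider the equation $$\sum_{k=0}^n\alpha_kM_ky(t)=f(t),\quad t\in[a,b]_{\mathbb{T}},\qquad M_0y=y,\quad M_{k+1}y=\varphi\,(M_ky)^\Delta. \tag{1}$$ Let $\lambda_1,\dots,\lambda_n\in\mathbb{C}$ be the characteristic values: $\alpha_k=s_{n-k}(-\lambda_1,\dots,-\lambda_n)$ for $0\le k\le n$, where $s_j$ is the $j$-th elementary symmetric polynomial. Assume that there is a constant $A>0$ such that, for all $t\in[a,\sigma^{n-1}(b)]_{\mathbb{T}}$, $$|\varphi(t)|\ge A\qquad\text{and}\qquad \varphi(t)+\lambda_k\mu(t)\ne 0,\quad k=1,\dots,n.$$ Then (1) has Hyers--Ulam stability on $[a,b]_{\mathbb{T}}$: there is a constant $K>0$ such that for every $\varepsilon>0$ and every $x$ with $M_kx\in C^1_{rd}$ on $[a,b]_{\mathbb{T}}$ for $0\le k\le n-1$ and $$\Big|\sum_{k=0}^n\alpha_kM_kx(t)-f(t)\Big|\le\varepsilon,\qquad t\in[a,b]_{\mathbb{T}},$$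 there is a solution $u$ of (1), with $M_ku\in C^1_{rd}$ on $[a,\sigma^{n-1-k}(b)]_{\mathbb{T}}\supseteq[a,b]_{\mathbb{T}}$ for $0\le k\le n-1$, such that $|x(t)-u(t)|\le K\varepsilon$ for all $t\in[a,\sigma^n(b)]_{\mathbb{T}}$. -/

import Mathlib

open Set Filter Topology

noncomputable section

namespace TimeScale

/-- The closed interval `[a, b]_T` of the time scale `T`. -/
def interval (T : Set ℝ) (a b : ℝ) : Set ℝ := T ∩ Icc a b

/-- The forward jump operator `σ` of the time scale `T`; it fixes the maximum of `T`, if any. -/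
def sigma (T : Set ℝ) (t : ℝ) : ℝ :=
  open Classical in if (T ∩ Ioi t).Nonempty then sInf (T ∩ Ioi t) else t

/-- The graininess `μ(t) = σ(t) - t`. -/
def mu (T : Set ℝ) (t : ℝ) : ℝ := sigma T t - t

/-- `E^κ`: the points of `E` at which a delta derivative of a function on `E` is unique, that is,
all points of `E` but a maximum of `E` that is not a limit from the left of points of `E`. -/
def kappa (E : Set ℝ) : Set ℝ :=
  {t ∈ E | (∃ s ∈ E, t < s) ∨ t ∈ closure (E ∩ Iio t)}

/-- The function `y`, considered on the subset `E` of the time scale `T`, has the delta derivative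
`D` at `t`: for every `ε > 0` one has `|y(σ(t)) - y(s) - D (σ(t) - s)| ≤ ε |σ(t) - s|` for all
`s ∈ E` near `t`. -/
def HasDeltaDeriv (T E : Set ℝ) (y : ℝ → ℝ) (D t : ℝ) : Prop :=
  ∀ ε > 0, ∀ᶠ s in 𝓝[E] t,
    |y (sigma T t) - y s - D * (sigma T t - s)| ≤ ε * |sigma T t - s|

/-- The delta derivative `y^Δ` (with the default value `0` where it does not exist). -/
def deltaDeriv (T E : Set ℝ) (y : ℝ → ℝ) (t : ℝ) : ℝ :=
  open Classical in if h : ∃ D, HasDeltaDeriv T E y D t then h.choose else 0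

/-- `g` is rd-continuous on the subset `S` of `T`: continuous at the points with `σ(t) = t`, with
finite left-sided limits at the left-dense points. -/
def RdContinuousOn (T S : Set ℝ) (g : ℝ → ℝ) : Prop :=
  (∀ t ∈ S, sigma T t = t → ContinuousWithinAt g S t) ∧
  (∀ t ∈ S, t ∈ closure (S ∩ Iio t) → ∃ l : ℝ, Tendsto g (𝓝[S ∩ Iio t] t) (𝓝 l))

/-- The class `C¹_rd` on `S`, for functions on `E ⊇ S`: delta differentiable at every point of `S`,
with a derivative that is rd-continuous on `S`. -/
def CrdOne (T E S : Set ℝ) (y : ℝ → ℝ) : Prop :=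
  (∀ t ∈ S, ∃ D, HasDeltaDeriv T E y D t) ∧ RdContinuousOn T S (deltaDeriv T E y)

/-- `M_0 y = y`, `M_{k+1} y = φ (M_k y)^Δ`. -/
def M (T E : Set ℝ) (φ : ℝ → ℝ) : ℕ → (ℝ → ℝ) → ℝ → ℝ
  | 0, y => y
  | k + 1, y => fun t => φ t * deltaDeriv T E (M T E φ k y) t

/-- The left-hand side `∑_{k=0}^n α_k M_k y` of the Cauchy-Euler equation. -/
def cauchyEuler (T E : Set ℝ) (n : ℕ) (α : ℕ → ℝ) (φ y : ℝ → ℝ) (t : ℝ) : ℝ :=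
  ∑ k ∈ Finset.range (n + 1), α k * M T E φ k y t

/-- The elementary symmetric polynomial `s_j(ρ_1, …, ρ_n)`. -/
def elemSymm {n : ℕ} (j : ℕ) (ρ : Fin n → ℂ) : ℂ :=
  ∑ S ∈ Finset.powersetCard j Finset.univ, ∏ i ∈ S, ρ i

/-- Hyers-Ulam stability on `[a, b]_T` of the equation `∑_{k=0}^n α_k M_k y = f`, for functions
given on `E ⊇ [a, σⁿ(b)]_T`. The constant `K` depends neither on `ε` nor on `x`. -/
def HyersUlamStable (T E : Set ℝ) (a b : ℝ) (n : ℕ) (α : ℕ → ℝ) (φ f : ℝ → ℝ) : Prop :=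
  ∃ K > 0, ∀ ε > 0, ∀ x : ℝ → ℝ,
    (∀ k < n, CrdOne T E (interval T a b) (M T E φ k x)) →
    (∀ t ∈ interval T a b, |cauchyEuler T E n α φ x t - f t| ≤ ε) →
    ∃ u : ℝ → ℝ,
      (∀ k < n, CrdOne T E (interval T a ((sigma T)^[n - 1 - k] b)) (M T E φ k u)) ∧
      (∀ t ∈ interval T a b, cauchyEuler T E n α φ u t = f t) ∧
      ∀ t ∈ interval T a ((sigma T)^[n] b), |x t - u t| ≤ K * ε

end TimeScale

end

/-! Put w = 1/φ. The equation is the first order system Z_k^Δ = w Z_{k+1} for k < n, with Z_n = f -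
∑_{k<n} α_k Z_k and Z_k = M_k u. Take for u the solution with the initial values M_k x(a). The
differences W_k = M_k x - Z_k vanish at a and satisfy W_k^Δ = w W_{k+1}, while |W_n| ≤ ε + ∑_{k<n}
|α_k| |W_k| on [a, b]_T. Gronwall (`abs_le_exp_of_hasDeltaDeriv`) bounds them by a multiple of ε. A
forward step y(σ(t)) = y(t) + μ(t) y^Δ(t) is explicit, so no coefficient has to be inverted except
φ.

Existence (`exists_eq_integral_linearField`) is a Picard fixed point; delta integrals are Lebesgue
integrals of step extensions. Each application of M_k loses some room at the right end, and
`exists_nested_endpoints` provides that room; `M_eq_of_hasDeltaDeriv` then recovers M_k u = Z_k.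
Beyond b nothing is assumed of x, but only the points σ^j(b), j ≤ n, remain; those that still jump
are isolated, so the recurrence there is automatic (`M_sub_iterate_sigma`, `abs_iterate_sigma_le`).
-/

namespace TimeScale

variable {T : Set ℝ}

/-! ### Jumps and intervals of a time scale -/

theorem le_sigma (T : Set ℝ) (t : ℝ) : t ≤ sigma T t := by
  unfold sigma
  split_ifs with h
  · exact le_csInf h fun s hs => hs.2.le
  · exact le_rfl

theorem sigma_le_of_lt {s t : ℝ} (hs : s ∈ T) (hts : t < s) : sigma T t ≤ s := by
  have h : (T ∩ Ioi t).Nonempty := ⟨s, hs, hts⟩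
  rw [sigma, if_pos h]
  exact csInf_le ⟨t, fun r hr => hr.2.le⟩ ⟨hs, hts⟩

theorem sigma_mem (hT : IsClosed T) {t : ℝ} (ht : t ∈ T) : sigma T t ∈ T := by
  unfold sigma
  split_ifs with h
  · exact hT.closure_subset_iff.2 inter_subset_left
      (csInf_mem_closure h ⟨t, fun r hr => hr.2.le⟩)
  · exact ht

theorem iterate_sigma_mem (hT : IsClosed T) {t : ℝ} (ht : t ∈ T) (j : ℕ) :
    (sigma T)^[j] t ∈ T := by
  induction j with
  | zero => exact ht
  | succ j ih => rw [Function.iterate_succ_apply']; exact sigma_mem hT ih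

theorem monotone_iterate_sigma (T : Set ℝ) (t : ℝ) : Monotone fun j => (sigma T)^[j] t :=
  monotone_nat_of_le_succ fun j => by
    rw [Function.iterate_succ_apply']; exact le_sigma _ _

theorem le_iterate_sigma (T : Set ℝ) (t : ℝ) (j : ℕ) : t ≤ (sigma T)^[j] t :=
  monotone_iterate_sigma T t (Nat.zero_le j)

/-- Points of `T` accumulate from the right at a right-dense point that is not the maximum. -/
theorem exists_mem_Ioo_of_sigma_eq {s t r : ℝ} (hs : s ∈ T) (hts : t < s) (h : sigma T t = t)
    (hr : t < r) : ∃ p ∈ T, t < p ∧ p < r := by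
  have hne : (T ∩ Ioi t).Nonempty := ⟨s, hs, hts⟩
  rw [sigma, if_pos hne] at h
  obtain ⟨p, hp, hpr⟩ := exists_lt_of_csInf_lt hne (h.trans_lt hr)
  exact ⟨p, hp.1, hp.2, hpr⟩

/-- A point of `T` between `b` and `σⁿ(b)` is reached from `b` by jumps. -/
theorem exists_iterate_sigma_eq {b t : ℝ} (ht : t ∈ T) (hbt : b < t) {n : ℕ}
    (htn : t ≤ (sigma T)^[n] b) : ∃ j, 1 ≤ j ∧ j ≤ n ∧ t = (sigma T)^[j] b := by
  induction n with
  | zero => exact absurd htn (not_le.2 hbt)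
  | succ n ih =>
    rcases le_or_gt t ((sigma T)^[n] b) with h | h
    · obtain ⟨j, h1, h2, h3⟩ := ih h
      exact ⟨j, h1, h2.trans n.le_succ, h3⟩
    · refine ⟨n + 1, by omega, le_rfl, htn.antisymm ?_⟩
      rw [Function.iterate_succ_apply']
      exact sigma_le_of_lt ht h

theorem interval_subset_interval {a b c : ℝ} (h : b ≤ c) : interval T a b ⊆ interval T a c :=
  inter_subset_inter_right _ (Icc_subset_Icc_right h)

theorem isCompact_interval (hT : IsClosed T) (a b : ℝ) : IsCompact (interval T a b) :=
  isCompact_Icc.inter_left hT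

/-! ### Delta derivatives and their uniqueness -/

section DeltaDeriv

variable {E : Set ℝ} {y z : ℝ → ℝ} {D D' t : ℝ}

theorem HasDeltaDeriv.sub (hy : HasDeltaDeriv T E y D t) (hz : HasDeltaDeriv T E z D' t) :
    HasDeltaDeriv T E (fun s => y s - z s) (D - D') t := by
  intro ε hε
  filter_upwards [hy (ε / 2) (by positivity), hz (ε / 2) (by positivity)] with s h1 h2
  have e : y (sigma T t) - z (sigma T t) - (y s - z s) - (D - D') * (sigma T t - s)
      = (y (sigma T t) - y s - D * (sigma T t - s))
        - (z (sigma T t) - z s - D' * (sigma T t - s)) := by ring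
  rw [e]
  refine (abs_sub _ _).trans ?_
  linarith

theorem HasDeltaDeriv.congr (hy : HasDeltaDeriv T E y D t) (h : ∀ᶠ s in 𝓝[E] t, z s = y s)
    (hσ : z (sigma T t) = y (sigma T t)) : HasDeltaDeriv T E z D t := by
  intro ε hε
  filter_upwards [hy ε hε, h] with s h1 h2
  rwa [hσ, h2]

/-- The point s = t is itself admissible in the definition, for every ε. -/
theorem HasDeltaDeriv.apply_sigma (hy : HasDeltaDeriv T E y D t) (ht : t ∈ E) :
    y (sigma T t) = y t + D * (sigma T t - t) := by
  have h : |y (sigma T t) - y t - D * (sigma T t - t)| ≤ 0 := by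
    refine le_of_forall_pos_le_add fun η hη => ?_
    have hp : 0 < |sigma T t - t| + 1 := by positivity
    have := (hy (η / (|sigma T t - t| + 1)) (by positivity)).self_of_nhdsWithin ht
    refine this.trans ?_
    rw [zero_add, div_mul_eq_mul_div, div_le_iff₀ hp]
    nlinarith
  have := abs_nonpos_iff.1 h
  linarith

/-- Near `t`, the increment of `y` is controlled by its delta derivative at `t`. -/
theorem HasDeltaDeriv.eventually_abs_sub_le (hy : HasDeltaDeriv T E y D t) (ht : t ∈ E) {ε : ℝ}
    (hε : 0 < ε) : ∀ᶠ s in 𝓝[E] t, |y s - y t| ≤ |D| * |s - t| + ε * |sigma T t - s| := by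
  filter_upwards [hy ε hε] with s hs
  have h := hy.apply_sigma ht
  have e : y s - y t = D * (s - t) - (y (sigma T t) - y s - D * (sigma T t - s)) := by
    rw [h]; ring
  rw [e]
  refine (abs_sub _ _).trans ?_
  rw [abs_mul]
  linarith

theorem HasDeltaDeriv.continuousWithinAt (hy : HasDeltaDeriv T E y D t) (ht : t ∈ E) :
    ContinuousWithinAt y E t := by
  rw [Metric.continuousWithinAt_iff']
  intro η hη
  set m := sigma T t - t
  have hm : 0 ≤ m := sub_nonneg.2 (le_sigma T t)
  have hlim : Tendsto (fun s => |D| * |s - t| + η / (2 * (m + 1)) * |sigma T t - s|) (𝓝[E] t)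
      (𝓝 (|D| * |t - t| + η / (2 * (m + 1)) * |sigma T t - t|)) := by
    apply Tendsto.mono_left _ nhdsWithin_le_nhds
    apply Continuous.tendsto
    fun_prop
  -- The increment bound does not vanish at s = t when t is right-scattered; the factor 1 / (2 (m +
  -- 1)) keeps it below η.
  have hlt : |D| * |t - t| + η / (2 * (m + 1)) * |sigma T t - t| < η := by
    rw [sub_self, abs_zero, mul_zero, zero_add, abs_of_nonneg hm, div_mul_eq_mul_div,
      div_lt_iff₀ (by positivity)]
    change η * m < _
    nlinarith
  filter_upwards [hy.eventually_abs_sub_le ht (ε := η / (2 * (m + 1))) (by positivity),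
    hlim.eventually_lt_const hlt] with s h1 h2
  rw [Real.dist_eq]
  exact h1.trans_lt h2

theorem deltaDeriv_spec (h : ∃ D, HasDeltaDeriv T E y D t) :
    HasDeltaDeriv T E y (deltaDeriv T E y t) t := by
  rw [deltaDeriv, dif_pos h]
  exact h.choose_spec

/-- The two estimates give |D - D'| |σ(t) - s| ≤ η |σ(t) - s|, and one nearby s ≠ σ(t) permits
division. -/
theorem HasDeltaDeriv.unique_of_frequently (hy : HasDeltaDeriv T E y D t)
    (hy' : HasDeltaDeriv T E y D' t) (h : ∃ᶠ s in 𝓝[E] t, s ≠ sigma T t) : D = D' := by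
  have h0 : |D - D'| ≤ 0 := by
    refine le_of_forall_pos_le_add fun η hη => ?_
    obtain ⟨s, hs, h1, h2⟩ := (h.and_eventually
      ((hy (η / 2) (by positivity)).and (hy' (η / 2) (by positivity)))).exists
    have hp : 0 < |sigma T t - s| := abs_pos.2 (sub_ne_zero.2 hs.symm)
    refine le_of_mul_le_mul_right ?_ hp
    rw [← abs_mul]
    have e : (D - D') * (sigma T t - s) = (y (sigma T t) - y s - D' * (sigma T t - s))
        - (y (sigma T t) - y s - D * (sigma T t - s)) := by ring
    rw [e]
    refine (abs_sub _ _).trans ?_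
    linarith
  exact sub_eq_zero.1 (abs_nonpos_iff.1 h0)

/-- If t is right-scattered, s = t serves; otherwise points of E accumulate at t from the right or
from the left. -/
theorem frequently_ne_sigma {a d : ℝ} (ht : t ∈ kappa (interval T a d)) :
    ∃ᶠ s in 𝓝[interval T a d] t, s ≠ sigma T t := by
  obtain ⟨htE, h⟩ := ht
  by_cases hσ : sigma T t = t
  · rw [hσ]
    rcases h with ⟨s, hs, hts⟩ | h
    · rw [frequently_iff]
      intro U hU
      obtain ⟨v, hv, hvU⟩ := mem_nhdsWithin_iff_exists_mem_nhds_inter.1 hU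
      obtain ⟨l, hl, hlv⟩ := exists_Ico_subset_of_mem_nhds hv ⟨s, hts⟩
      obtain ⟨p, hp, htp, hpr⟩ := exists_mem_Ioo_of_sigma_eq hs.1 hts hσ (lt_min hl hts)
      have hp' := lt_min_iff.1 hpr
      exact ⟨p, hvU ⟨hlv ⟨htp.le, hp'.1⟩, hp, htE.2.1.trans htp.le, hp'.2.le.trans hs.2.2⟩,
        htp.ne'⟩
    · have := mem_closure_iff_nhdsWithin_neBot.1 h
      have h2 : ∃ᶠ s in 𝓝[interval T a d ∩ Iio t] t, s ≠ t :=
        (eventually_mem_nhdsWithin.mono fun s hs => (hs.2 : s < t).ne).frequently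
      exact h2.filter_mono (nhdsWithin_mono _ inter_subset_left)
  · rw [frequently_iff]
    intro U hU
    exact ⟨t, mem_of_mem_nhdsWithin htE hU, Ne.symm hσ⟩

theorem HasDeltaDeriv.deltaDeriv_eq {a d : ℝ} (hy : HasDeltaDeriv T (interval T a d) y D t)
    (ht : t ∈ kappa (interval T a d)) : deltaDeriv T (interval T a d) y t = D :=
  (deltaDeriv_spec ⟨D, hy⟩).unique_of_frequently hy (frequently_ne_sigma ht)

/-- Every function is delta differentiable at an isolated right-scattered point. -/
theorem exists_hasDeltaDeriv_of_isolated (hσ : t < sigma T t) (h : ∀ᶠ s in 𝓝[E] t, s = t)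
    (y : ℝ → ℝ) : ∃ D, HasDeltaDeriv T E y D t := by
  refine ⟨(y (sigma T t) - y t) / (sigma T t - t), fun ε hε => ?_⟩
  filter_upwards [h] with s hs
  rw [hs, div_mul_cancel₀ _ (sub_pos.2 hσ).ne', sub_self, abs_zero]
  positivity

end DeltaDeriv

/-! ### Induction on a time scale and a Gronwall estimate -/

/-- A jump point `t = σ(p) > p` of `T` with `σ(t) > t` is isolated. -/
theorem eventually_eq_of_isolated {p : ℝ} {E : Set ℝ} (hE : E ⊆ T) (hp : p < sigma T p)
    (hσ : sigma T p < sigma T (sigma T p)) : ∀ᶠ s in 𝓝[E] (sigma T p), s = sigma T p := by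
  filter_upwards [self_mem_nhdsWithin, nhdsWithin_le_nhds (Ioo_mem_nhds hp hσ)] with s hs h
  rcases lt_trichotomy s (sigma T p) with h1 | h1 | h1
  · exact absurd (sigma_le_of_lt (hE hs) h.1) (not_le.2 h1)
  · exact h1
  · exact absurd (sigma_le_of_lt (hE hs) h1) (not_le.2 h.2)

/-- Induction along the time scale interval `[a, b]_T`. -/
theorem interval_induction (hT : IsClosed T) {a b : ℝ} (ha : a ∈ T) {P : ℝ → Prop} (h0 : P a)
    (hscat : ∀ t ∈ interval T a b, t < sigma T t → P t → P (sigma T t))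
    (hright : ∀ t ∈ interval T a b, sigma T t = t → P t →
      ∀ᶠ s in 𝓝[interval T a b ∩ Ioi t] t, P s)
    (hleft : ∀ t ∈ interval T a b, t ∈ closure (interval T a b ∩ Iio t) →
      (∀ s ∈ interval T a b ∩ Iio t, P s) → P t) :
    ∀ t ∈ interval T a b, P t := by
  by_contra! hcon
  set S := {t | t ∈ interval T a b ∧ ¬ P t} with hS
  have hne : S.Nonempty := hcon
  have hbdd : BddBelow S := ⟨a, fun s hs => hs.1.2.1⟩
  set m := sInf S
  have hm : m ∈ interval T a b :=
    (isCompact_interval hT a b).isClosed.closure_subset_iff.2 (fun s hs => hs.1)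
      (csInf_mem_closure hne hbdd)
  have hbelow : ∀ s ∈ interval T a b ∩ Iio m, P s := fun s hs => by
    by_contra hP
    exact absurd (csInf_le hbdd ⟨hs.1, hP⟩) (not_le.2 hs.2)
  -- The infimum m of the counterexamples is left-dense, or equal to a, or the jump of the largest
  -- point below it.
  have hPm : P m := by
    by_cases hl : m ∈ closure (interval T a b ∩ Iio m)
    · exact hleft m hm hl hbelow
    rcases hm.2.1.eq_or_lt with ham | ham
    · rwa [← ham]
    set L := interval T a b ∩ Iio m with hL
    have hLne : L.Nonempty := ⟨a, ⟨ha, le_rfl, hm.2.1.trans hm.2.2⟩, ham⟩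
    have hLb : BddAbove L := ⟨m, fun s hs => (hs.2 : s < m).le⟩
    have hpc : sSup L ∈ closure L := csSup_mem_closure hLne hLb
    have hpE : sSup L ∈ interval T a b :=
      (isCompact_interval hT a b).isClosed.closure_subset_iff.2 inter_subset_left hpc
    have hpm : sSup L < m :=
      (csSup_le hLne fun s hs => (hs.2 : s < m).le).lt_of_ne fun h => hl (h ▸ hpc)
    have hσ : sigma T (sSup L) = m := by
      refine (sigma_le_of_lt hm.1 hpm).antisymm ?_
      have hne' : (T ∩ Ioi (sSup L)).Nonempty := ⟨m, hm.1, hpm⟩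
      rw [sigma, if_pos hne']
      refine le_csInf hne' fun s hs => ?_
      by_contra! hsm
      exact absurd (le_csSup hLb ⟨⟨hs.1, hpE.2.1.trans (hs.2 : _ < s).le,
        hsm.le.trans hm.2.2⟩, hsm⟩) (not_le.2 hs.2)
    rw [← hσ]
    exact hscat _ hpE (hσ ▸ hpm) (hbelow _ ⟨hpE, hpm⟩)
  have hgt : ∀ s ∈ S, m < s := fun s hs =>
    (csInf_le hbdd hs).lt_of_ne fun h => hs.2 (h ▸ hPm)
  rcases (le_sigma T m).eq_or_lt with h | h
  · obtain ⟨v, hv, hvP⟩ := mem_nhdsWithin_iff_exists_mem_nhds_inter.1 (hright m hm h.symm hPm)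
    obtain ⟨s, hs⟩ := hne
    obtain ⟨l, hl, hlv⟩ := exists_Ico_subset_of_mem_nhds hv ⟨s, hgt s hs⟩
    obtain ⟨r, hr, hrl⟩ := exists_lt_of_csInf_lt ⟨s, hs⟩ hl
    exact hr.2 (hvP ⟨hlv ⟨(hgt r hr).le, hrl⟩, hr.1, hgt r hr⟩)
  · obtain ⟨r, hr, hrl⟩ := exists_lt_of_csInf_lt hne h
    exact absurd (sigma_le_of_lt hr.1.1 (hgt r hr)) (not_le.2 hrl)

/-- A Gronwall estimate for finitely many functions that vanish at `a`. -/
theorem abs_le_exp_of_hasDeltaDeriv (hT : IsClosed T) {a b : ℝ} (ha : a ∈ T) {E : Set ℝ}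
    (hE : interval T a b ⊆ E) {n : ℕ} {W D : ℕ → ℝ → ℝ}
    (hW : ∀ k < n, ∀ t ∈ interval T a b, HasDeltaDeriv T E (W k) (D k t) t)
    (h0 : ∀ k < n, W k a = 0) {L η : ℝ} (hL : 0 ≤ L) (hη : 0 < η)
    (hD : ∀ t ∈ interval T a b, ∀ q, (∀ k < n, |W k t| ≤ q) → ∀ k < n, |D k t| ≤ L * q + η) :
    ∀ t ∈ interval T a b, ∀ k < n, |W k t| ≤ 2 * η * Real.exp ((L + 1) * (t - a)) ∧
      |W k (sigma T t)| ≤ 2 * η * Real.exp ((L + 1) * (sigma T t - a)) := by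
  -- A strict supersolution: as q ≥ 2η, its rate (L + 1) q exceeds L q + η by another η, which pays
  -- for the error in the definition of the derivative at right-dense points.
  set q : ℝ → ℝ := fun t => 2 * η * Real.exp ((L + 1) * (t - a)) with hq
  have hq2 : ∀ t, a ≤ t → 2 * η ≤ q t := fun t ht => by
    have : 1 ≤ Real.exp ((L + 1) * (t - a)) :=
      Real.one_le_exp (mul_nonneg (by linarith) (sub_nonneg.2 ht))
    simp only [hq]
    nlinarith
  have hqs : ∀ t s, q t + (L + 1) * q t * (s - t) ≤ q s := fun t s => by
    have e : q s = q t * Real.exp ((L + 1) * (s - t)) := by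
      simp only [hq]
      rw [mul_assoc (2 * η), ← Real.exp_add]
      congr 3
      ring
    have h1 := Real.add_one_le_exp ((L + 1) * (s - t))
    have h2 : 0 ≤ q t := by simp only [hq]; positivity
    rw [e]
    nlinarith [mul_le_mul_of_nonneg_left h1 h2]
  have hstep : ∀ t ∈ interval T a b, (∀ k < n, |W k t| ≤ q t) →
      ∀ k < n, |W k (sigma T t)| ≤ q (sigma T t) := fun t ht hP k hk => by
    have hDk := hD t ht (q t) hP k hk
    have hμ : 0 ≤ sigma T t - t := sub_nonneg.2 (le_sigma T t)
    rw [(hW k hk t ht).apply_sigma (hE ht)]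
    refine (abs_add_le _ _).trans (le_trans ?_ (hqs t (sigma T t)))
    rw [abs_mul, abs_of_nonneg hμ]
    refine add_le_add (hP k hk) (mul_le_mul_of_nonneg_right ?_ hμ)
    linarith [hq2 t ht.2.1]
  have hall : ∀ t ∈ interval T a b, ∀ k < n, |W k t| ≤ q t := by
    refine interval_induction hT ha ?_ (fun t ht _ => hstep t ht) ?_ ?_
    · intro k hk
      rw [h0 k hk, abs_zero]
      linarith [hq2 a le_rfl]
    · intro t ht hσ hP
      have hev : ∀ k ∈ Finset.range n, ∀ᶠ s in 𝓝[interval T a b ∩ Ioi t] t,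
          |W k s| ≤ q s := fun k hk => by
        have hk := Finset.mem_range.1 hk
        have h1 := ((hW k hk t ht).eventually_abs_sub_le (hE ht) hη).filter_mono
          (nhdsWithin_mono t (inter_subset_left.trans hE : interval T a b ∩ Ioi t ⊆ E))
        filter_upwards [h1, self_mem_nhdsWithin] with s hs hst
        have hts : 0 < s - t := sub_pos.2 hst.2
        rw [hσ, abs_sub_comm t s, abs_of_pos hts] at hs
        have hDk := hD t ht (q t) hP k hk
        have h2 := abs_sub_abs_le_abs_sub (W k s) (W k t)
        have h3 : (|D k t| + η) * (s - t) ≤ (L + 1) * q t * (s - t) :=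
          mul_le_mul_of_nonneg_right (by linarith [hq2 t ht.2.1]) hts.le
        linarith [hP k hk, hqs t s]
      filter_upwards [(Finset.range n).eventually_all.2 hev] with s hs k hk
      exact hs k (Finset.mem_range.2 hk)
    · intro t ht hl hP k hk
      have := mem_closure_iff_nhdsWithin_neBot.1 hl
      have hc := ((hW k hk t ht).continuousWithinAt (hE ht)).mono
        (inter_subset_left.trans hE : interval T a b ∩ Iio t ⊆ E)
      have hqc : Tendsto q (𝓝[interval T a b ∩ Iio t] t) (𝓝 (q t)) :=
        (Continuous.tendsto (by fun_prop) t).mono_left nhdsWithin_le_nhds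
      refine le_of_tendsto_of_tendsto hc.abs hqc ?_
      filter_upwards [self_mem_nhdsWithin] with s hs
      exact hP s hs k hk
  exact fun t ht k hk => ⟨hall t ht k hk, hstep t ht (hall t ht) k hk⟩

end TimeScale

/-! ### The delta integral as the Lebesgue integral of a step extension -/

noncomputable section
namespace TimeScale

variable {T : Set ℝ} {a d : ℝ}

/-- The last point of `[a, d]_T` that is not greater than `s`. -/
def lastPoint (T : Set ℝ) (a d s : ℝ) : ℝ := sSup (interval T a d ∩ Iic s)

theorem bddAbove_interval_inter_Iic (T : Set ℝ) (a d s : ℝ) :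
    BddAbove (interval T a d ∩ Iic s) := ⟨s, fun _ h => h.2⟩

theorem lastPoint_mem (hT : IsClosed T) (ha : a ∈ T) (had : a ≤ d) {s : ℝ} (hs : a ≤ s) :
    lastPoint T a d s ∈ interval T a d ∩ Iic s :=
  ((isCompact_interval hT a d).isClosed.inter isClosed_Iic).csSup_mem
    ⟨a, ⟨ha, le_rfl, had⟩, hs⟩ (bddAbove_interval_inter_Iic T a d s)

theorem le_lastPoint {r s : ℝ} (hr : r ∈ interval T a d) (hrs : r ≤ s) :
    r ≤ lastPoint T a d s :=
  le_csSup (bddAbove_interval_inter_Iic T a d s) ⟨hr, hrs⟩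

/-- The junk value left of a does not depend on s, so step extensions are right-continuous there
too. -/
theorem lastPoint_of_lt {s : ℝ} (hs : s < a) : lastPoint T a d s = sSup ∅ := by
  rw [lastPoint]
  congr 1
  exact eq_empty_of_forall_notMem fun r hr => absurd (hr.1.2.1.trans hr.2) (not_le.2 hs)

/-- Before the next jump, `lastPoint` is constant. -/
theorem lastPoint_eq_of_lt_sigma (hT : IsClosed T) (ha : a ∈ T) (had : a ≤ d) {t s : ℝ}
    (ht : t ∈ interval T a d) (hts : t ≤ s) (hs : s < sigma T t) : lastPoint T a d s = t := by
  have h := lastPoint_mem hT ha had (ht.2.1.trans hts)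
  refine le_antisymm ?_ (le_lastPoint ht hts)
  by_contra! hlt
  exact absurd ((sigma_le_of_lt h.1.1 hlt).trans h.2) (not_le.2 hs)

variable {V : Type*} [NormedAddCommGroup V]

/-- The extension of an rd-continuous function to a step function on the line is
right-continuous. -/
theorem continuousWithinAt_comp_lastPoint (hT : IsClosed T) (ha : a ∈ T) (hd : d ∈ T)
    (had : a ≤ d) {h : ℝ → V}
    (hc : ∀ t ∈ interval T a d, sigma T t = t → ContinuousWithinAt h (interval T a d) t)
    (t : ℝ) : ContinuousWithinAt (fun s => h (lastPoint T a d s)) (Ioi t) t := by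
  rcases lt_or_ge t a with hta | hta
  · refine (continuousWithinAt_const (b := h (sSup ∅))).congr_of_eventuallyEq ?_ ?_
    · filter_upwards [nhdsWithin_le_nhds (Iio_mem_nhds hta)] with s hs
      rw [lastPoint_of_lt hs]
    · rw [lastPoint_of_lt hta]
  have hdE : d ∈ interval T a d := ⟨hd, had, le_rfl⟩
  rcases le_or_gt d t with htd | htd
  · have key : ∀ s, d ≤ s → lastPoint T a d s = d := fun s hs =>
      (lastPoint_mem hT ha had (had.trans hs)).1.2.2.antisymm (le_lastPoint hdE hs)
    refine (continuousWithinAt_const (b := h d)).congr_of_eventuallyEq ?_ ?_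
    · filter_upwards [self_mem_nhdsWithin] with s hs
      rw [key s (htd.trans (le_of_lt hs))]
    · rw [key t htd]
  set p := lastPoint T a d t with hp
  have hpm := lastPoint_mem hT ha had hta
  rw [← hp] at hpm
  have hpt : p ≤ t := hpm.2
  -- If p is right-dense then p = t, and last points just after t tend to t; if p is
  -- right-scattered, the extension is constant up to σ(p).
  rcases (le_sigma T p).eq_or_lt with hσ | hσ
  · have hpeq : p = t := by
      refine hpt.antisymm (not_lt.1 fun hlt => ?_)
      obtain ⟨r, hr, hpr, hrt⟩ := exists_mem_Ioo_of_sigma_eq hd (hpt.trans_lt htd) hσ.symm hlt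
      exact absurd (le_lastPoint ⟨hr, hpm.1.2.1.trans hpr.le, (hrt.trans htd).le⟩ hrt.le)
        (not_le.2 hpr)
    have hcp := hc p hpm.1 hσ.symm
    rw [hpeq] at hcp hpm
    unfold ContinuousWithinAt at hcp ⊢
    beta_reduce
    rw [← hp, hpeq]
    refine hcp.comp (tendsto_nhdsWithin_iff.2 ⟨?_, ?_⟩)
    · refine tendsto_of_tendsto_of_tendsto_of_le_of_le' tendsto_const_nhds
        (tendsto_id.mono_left nhdsWithin_le_nhds) ?_ ?_
      · filter_upwards [self_mem_nhdsWithin] with s hs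
        exact le_lastPoint hpm.1 (le_of_lt hs)
      · filter_upwards [self_mem_nhdsWithin] with s hs
        exact (lastPoint_mem hT ha had (hta.trans (le_of_lt hs))).2
    · filter_upwards [self_mem_nhdsWithin] with s hs
      exact (lastPoint_mem hT ha had (hta.trans (le_of_lt hs))).1
  · have htσ : t < sigma T p := by
      by_contra! hle
      exact absurd (le_lastPoint ⟨sigma_mem hT hpm.1.1, hpm.1.2.1.trans hσ.le,
        hle.trans htd.le⟩ hle) (not_le.2 hσ)
    refine (continuousWithinAt_const (b := h p)).congr_of_eventuallyEq ?_ rfl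
    filter_upwards [self_mem_nhdsWithin, nhdsWithin_le_nhds (Iio_mem_nhds htσ)] with s hs hsσ
    rw [lastPoint_eq_of_lt_sigma hT ha had hpm.1 (hpt.trans (le_of_lt hs)) hsσ]

/-- A right-continuous function on the line is strongly measurable. -/
theorem stronglyMeasurable_of_continuousWithinAt_Ioi {H : ℝ → V}
    (hH : ∀ t, ContinuousWithinAt H (Ioi t) t) : MeasureTheory.StronglyMeasurable H := by
  have hpos : ∀ m : ℕ, (0 : ℝ) < m + 1 := fun m => by positivity
  -- Sample at the first point of the grid ℤ / (m + 1) strictly to the right of s; strictness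
  -- matters, as continuity is only known within `Ioi`.
  refine stronglyMeasurable_of_tendsto atTop
    (f := fun (m : ℕ) (s : ℝ) => H ((⌊(m + 1 : ℝ) * s⌋ + 1 : ℝ) / (m + 1))) (fun m => ?_) ?_
  · have h1 : MeasureTheory.StronglyMeasurable fun z : ℤ => H ((z + 1 : ℝ) / (m + 1)) :=
      MeasureTheory.StronglyMeasurable.of_discrete
    exact h1.comp_measurable (Int.measurable_floor.comp (measurable_const_mul (m + 1 : ℝ)))
  · refine tendsto_pi_nhds.2 fun s => (hH s).tendsto.comp (tendsto_nhdsWithin_iff.2 ⟨?_, ?_⟩)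
    · have hup : Tendsto (fun m : ℕ => s + 1 / ((m : ℝ) + 1)) atTop (𝓝 s) := by
        simpa using tendsto_const_nhds.add (tendsto_one_div_add_atTop_nhds_zero_nat (𝕜 := ℝ))
      refine tendsto_of_tendsto_of_tendsto_of_le_of_le tendsto_const_nhds hup
        (fun m => ?_) (fun m => ?_)
      · change s ≤ _ / _
        rw [le_div_iff₀ (hpos m)]
        linarith [Int.lt_floor_add_one ((m + 1 : ℝ) * s)]
      · change _ / _ ≤ _
        rw [div_le_iff₀ (hpos m), add_mul s, one_div_mul_cancel (hpos m).ne']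
        linarith [Int.floor_le ((m + 1 : ℝ) * s)]
    · refine Eventually.of_forall fun m => ?_
      change s < _ / _
      rw [lt_div_iff₀ (hpos m)]
      linarith [Int.lt_floor_add_one ((m + 1 : ℝ) * s)]

theorem intervalIntegrable_comp_lastPoint (hT : IsClosed T) (ha : a ∈ T) (hd : d ∈ T)
    (had : a ≤ d) {h : ℝ → V}
    (hc : ∀ t ∈ interval T a d, sigma T t = t → ContinuousWithinAt h (interval T a d) t)
    {B : ℝ} (hB : ∀ t ∈ interval T a d, ‖h t‖ ≤ B) {r s : ℝ} (hr : a ≤ r) (hs : a ≤ s) :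
    IntervalIntegrable (fun s => h (lastPoint T a d s)) MeasureTheory.volume r s := by
  rw [intervalIntegrable_iff]
  refine MeasureTheory.IntegrableOn.of_bound ?_
    ((stronglyMeasurable_of_continuousWithinAt_Ioi
      (continuousWithinAt_comp_lastPoint hT ha hd had hc)).aestronglyMeasurable) B ?_
  · rw [uIoc]; exact measure_Ioc_lt_top
  · refine (MeasureTheory.ae_restrict_iff' measurableSet_uIoc).2 (Eventually.of_forall ?_)
    intro q hq
    exact hB _ (lastPoint_mem hT ha had ((le_min hr hs).trans (le_of_lt hq.1))).1

/-- The fundamental theorem of calculus for the delta integral. -/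
theorem hasDeltaDeriv_of_eq_integral (hT : IsClosed T) (ha : a ∈ T) (hd : d ∈ T) (had : a ≤ d)
    {h y : ℝ → ℝ}
    (hc : ∀ t ∈ interval T a d, sigma T t = t → ContinuousWithinAt h (interval T a d) t)
    {B : ℝ} (hB : ∀ t ∈ interval T a d, ‖h t‖ ≤ B)
    (hy : ∀ t ∈ Icc a d, y t = y a + ∫ s in a..t, h (lastPoint T a d s))
    {t : ℝ} (ht : t ∈ interval T a d) (hσ : sigma T t ≤ d) :
    HasDeltaDeriv T (interval T a d) y (h t) t := by
  have hint : ∀ {r s : ℝ}, a ≤ r → a ≤ s → IntervalIntegrable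
      (fun s => h (lastPoint T a d s)) MeasureTheory.volume r s :=
    intervalIntegrable_comp_lastPoint hT ha hd had hc hB
  have hsub : ∀ r ∈ Icc a d, ∀ s ∈ Icc a d,
      y s - y r = ∫ q in r..s, h (lastPoint T a d q) := fun r hr s hs => by
    rw [hy r hr, hy s hs, add_sub_add_left_eq_sub,
      intervalIntegral.integral_interval_sub_left (hint le_rfl hs.1) (hint le_rfl hr.1)]
  have hσm : sigma T t ∈ Icc a d := ⟨ht.2.1.trans (le_sigma T t), hσ⟩
  intro ε hε
  rcases (le_sigma T t).eq_or_lt with hrd | hrs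
  · have hc' := Metric.continuousWithinAt_iff.1 (hc t ht hrd.symm) ε hε
    obtain ⟨δ, hδ, hδ'⟩ := hc'
    filter_upwards [self_mem_nhdsWithin, nhdsWithin_le_nhds (Metric.ball_mem_nhds t hδ)]
      with s hs hsδ
    rw [← hrd]
    have e : y t - y s - h t * (t - s) = ∫ q in s..t, (h (lastPoint T a d q) - h t) := by
      rw [intervalIntegral.integral_sub (hint hs.2.1 ht.2.1) (by simp), ← hsub s hs.2 t ht.2,
        intervalIntegral.integral_const, smul_eq_mul, mul_comm]
    rw [e, ← Real.norm_eq_abs]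
    refine intervalIntegral.norm_integral_le_of_norm_le_const fun q hq => ?_
    have hq1 : min s t ≤ q := le_of_lt hq.1
    have hq2 : q ≤ max s t := hq.2
    have hl := lastPoint_mem hT ha had ((le_min hs.2.1 ht.2.1).trans hq1)
    -- Both s and t lie in T, so the last point before q cannot leave the segment between them.
    have hge : min s t ≤ lastPoint T a d q := by
      rcases min_choice s t with hm | hm <;> rw [hm] at hq1 ⊢
      · exact le_lastPoint hs hq1
      · exact le_lastPoint ht hq1
    have hle : lastPoint T a d q ≤ max s t := hl.2.trans hq2
    have hdist : dist (lastPoint T a d q) t < δ := by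
      refine lt_of_le_of_lt ?_ hsδ
      rw [Real.dist_eq, Real.dist_eq]
      refine abs_sub_left_of_mem_uIcc ?_
      rw [uIcc_comm]
      exact ⟨hge, hle⟩
    exact (hδ' hl.1 hdist).le
  · have hjump : y (sigma T t) - y t = h t * (sigma T t - t) := by
      rw [hsub t ht.2 _ hσm]
      have : ∫ q in t..sigma T t, h (lastPoint T a d q) = ∫ q in t..sigma T t, h t := by
        refine intervalIntegral.integral_congr_ae ?_
        have hne : ∀ᵐ q : ℝ, q ≠ sigma T t := by
          simp [MeasureTheory.ae_iff, MeasureTheory.measure_singleton]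
        filter_upwards [hne] with q hq hqm
        rw [uIoc_of_le hrs.le] at hqm
        rw [lastPoint_eq_of_lt_sigma hT ha had ht hqm.1.le (hqm.2.lt_of_ne hq)]
      rw [this, intervalIntegral.integral_const, smul_eq_mul, mul_comm]
    have hyc : Tendsto y (𝓝[interval T a d] t) (𝓝 (y t)) := by
      refine tendsto_iff_dist_tendsto_zero.2 (squeeze_zero' (g := fun s => B * |s - t|)
        (Eventually.of_forall fun s => dist_nonneg) ?_ ?_)
      · filter_upwards [self_mem_nhdsWithin] with s hs
        rw [Real.dist_eq, hsub t ht.2 s hs.2, ← Real.norm_eq_abs]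
        exact intervalIntegral.norm_integral_le_of_norm_le_const fun q hq =>
          hB _ (lastPoint_mem hT ha had ((le_min ht.2.1 hs.2.1).trans (le_of_lt hq.1))).1
      · have : Tendsto (fun s => B * |s - t|) (𝓝 t) (𝓝 (B * |t - t|)) :=
          Continuous.tendsto (by fun_prop) t
        rw [sub_self, abs_zero, mul_zero] at this
        exact this.mono_left nhdsWithin_le_nhds
    have hid : Tendsto (fun s : ℝ => s) (𝓝[interval T a d] t) (𝓝 t) :=
      tendsto_id.mono_left nhdsWithin_le_nhds
    have h1 : Tendsto (fun s => |y (sigma T t) - y s - h t * (sigma T t - s)|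
        - ε * |sigma T t - s|) (𝓝[interval T a d] t)
        (𝓝 (|y (sigma T t) - y t - h t * (sigma T t - t)| - ε * |sigma T t - t|)) :=
      ((tendsto_const_nhds.sub hyc).sub (tendsto_const_nhds.mul
        (tendsto_const_nhds.sub hid))).abs.sub
        (tendsto_const_nhds.mul (tendsto_const_nhds.sub hid).abs)
    -- The jump of y is exact and ε μ(t) > 0, so the inequality is strict at s = t and persists
    -- nearby by continuity of y.
    have h2 : |y (sigma T t) - y t - h t * (sigma T t - t)| - ε * |sigma T t - t| < 0 := by
      rw [hjump, sub_self, abs_zero, abs_of_pos (sub_pos.2 hrs)]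
      nlinarith [mul_pos hε (sub_pos.2 hrs)]
    filter_upwards [h1.eventually_lt_const h2] with s hs
    linarith

end TimeScale
end

/-! ### Initial value problems for linear systems -/

noncomputable section
namespace TimeScale

variable {T : Set ℝ} {a d : ℝ} {V : Type*} [NormedAddCommGroup V] [NormedSpace ℝ V]

/-- The right-hand side of the linear equation `Z^Δ = w (C Z + f e)`. -/
def linearField (w f : ℝ → ℝ) (C : V →L[ℝ] V) (e : V) (Z : ℝ → V) (t : ℝ) : V :=
  w t • (C (Z t) + f t • e)

theorem continuousWithinAt_linearField {w f : ℝ → ℝ} {E : Set ℝ} {t : ℝ}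
    (hw : ContinuousWithinAt w E t) (hf : ContinuousWithinAt f E t) (C : V →L[ℝ] V) (e : V)
    {Z : ℝ → V} (hZ : Continuous Z) : ContinuousWithinAt (linearField w f C e Z) E t :=
  hw.smul ((C.continuous.comp hZ).continuousWithinAt.add (hf.smul continuousWithinAt_const))

theorem exists_bound_linearField {w f : ℝ → ℝ} {B B' : ℝ}
    (hB : ∀ t ∈ interval T a d, |w t| ≤ B) (hB' : ∀ t ∈ interval T a d, |f t| ≤ B')
    (C : V →L[ℝ] V) (e : V) {Z : ℝ → V} (hZ : Continuous Z) :
    ∃ R, ∀ t ∈ interval T a d, ‖linearField w f C e Z t‖ ≤ R := by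
  obtain ⟨R, hR⟩ := isCompact_Icc.exists_bound_of_continuousOn (s := Icc a d) hZ.continuousOn
  refine ⟨B * (‖C‖ * R + B' * ‖e‖), fun t ht => ?_⟩
  have h1 : ‖C (Z t)‖ ≤ ‖C‖ * R := C.le_opNorm_of_le (hR t ht.2)
  have h2 : ‖f t • e‖ ≤ B' * ‖e‖ := by
    rw [norm_smul]
    exact mul_le_mul_of_nonneg_right (hB' t ht) (norm_nonneg e)
  rw [linearField, norm_smul]
  exact mul_le_mul (hB t ht) ((norm_add_le _ _).trans (add_le_add h1 h2)) (norm_nonneg _)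
    ((abs_nonneg _).trans (hB t ht))

theorem integral_exp_mul_sub_le {Λ : ℝ} (hΛ : 0 < Λ) (a t : ℝ) :
    ∫ s in a..t, Real.exp (Λ * (s - a)) ≤ Real.exp (Λ * (t - a)) / Λ := by
  have hder : ∀ s ∈ uIcc a t, HasDerivAt (fun s => Real.exp (Λ * (s - a)) / Λ)
      (Real.exp (Λ * (s - a))) s := fun s _ => by
    have h := ((((hasDerivAt_id s).sub_const a).const_mul Λ).exp).div_const Λ
    have e : Real.exp (Λ * (s - a)) = Real.exp (Λ * (s - a)) * (Λ * 1) / Λ := by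
      field_simp
    rw [e]
    exact h
  rw [intervalIntegral.integral_eq_sub_of_hasDerivAt hder
    (Continuous.intervalIntegrable (by fun_prop) _ _)]
  have : 0 ≤ Real.exp (Λ * (a - a)) / Λ := by positivity
  linarith

/-- The initial value problem for `Z^Δ = w (C Z + f e)` has a solution, in integrated form. -/
theorem exists_eq_integral_linearField [CompleteSpace V] (hT : IsClosed T) (ha : a ∈ T)
    (hd : d ∈ T) (had : a ≤ d) {w f : ℝ → ℝ}
    (hw : ∀ t ∈ interval T a d, sigma T t = t → ContinuousWithinAt w (interval T a d) t)
    (hf : ∀ t ∈ interval T a d, sigma T t = t → ContinuousWithinAt f (interval T a d) t)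
    {B B' : ℝ} (hB : ∀ t ∈ interval T a d, |w t| ≤ B)
    (hB' : ∀ t ∈ interval T a d, |f t| ≤ B') (C : V →L[ℝ] V) (e z₀ : V) :
    ∃ Z : ℝ → V, Continuous Z ∧ ∀ t ∈ Icc a d,
      Z t = z₀ + ∫ s in a..t, linearField w f C e Z (lastPoint T a d s) := by
  have hB0 : 0 ≤ B := (abs_nonneg _).trans (hB a ⟨ha, le_rfl, had⟩)
  -- Exponential weight for the sup norm: the Picard map has Lipschitz constant B‖C‖/Λ ≤ 1/2 on all
  -- of [a, d]. The unknown y is the solution divided by exp(Λ(t - a)); the summand 1 keeps Λ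
  -- positive.
  set Λ := 2 * (B * ‖C‖) + 1 with hΛdef
  have hΛ : 0 < Λ := by positivity
  set ext : C(Icc a d, V) → ℝ → V := fun y t =>
    Real.exp (Λ * (t - a)) • y (projIcc a d had t) with hext
  have hextc : ∀ y, Continuous (ext y) := fun y => by
    have h1 : Continuous fun t => y (projIcc a d had t) := y.continuous.comp continuous_projIcc
    have h2 : Continuous fun t => Real.exp (Λ * (t - a)) := by fun_prop
    exact h2.smul h1
  have hint : ∀ y, ∀ {r s : ℝ}, a ≤ r → a ≤ s → IntervalIntegrable
      (fun s => linearField w f C e (ext y) (lastPoint T a d s))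
        MeasureTheory.volume r s := fun y r s hr hs => by
    obtain ⟨R, hR⟩ := exists_bound_linearField hB hB' C e (hextc y)
    exact intervalIntegrable_comp_lastPoint hT ha hd had (fun t ht hσ =>
      continuousWithinAt_linearField (hw t ht hσ) (hf t ht hσ) C e (hextc y)) hR hr hs
  have hcont : ∀ y, Continuous fun t : Icc a d => Real.exp (-(Λ * (t - a))) •
      (z₀ + ∫ s in a..(t : ℝ), linearField w f C e (ext y) (lastPoint T a d s)) := fun y => by
    have hp := intervalIntegral.continuousOn_primitive_interval'
      (hint y le_rfl had) (left_mem_uIcc (a := a) (b := d))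
    rw [uIcc_of_le had] at hp
    have h2 : Continuous fun t : Icc a d => Real.exp (-(Λ * (t - a))) := by fun_prop
    exact h2.smul (continuous_const.add (continuousOn_iff_continuous_domRestrict.1 hp))
  set Q : C(Icc a d, V) → C(Icc a d, V) := fun y => ⟨_, hcont y⟩ with hQ
  have hcontr : ContractingWith (1 / 2) Q := by
    refine ⟨by rw [div_lt_one] <;> norm_num, LipschitzWith.of_dist_le_mul fun y y' => ?_⟩
    have hnn : 0 ≤ dist y y' := dist_nonneg
    refine (ContinuousMap.dist_le (by positivity)).2 fun t => ?_
    have hat : a ≤ (t : ℝ) := t.2.1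
    have e1 : Q y t - Q y' t = Real.exp (-(Λ * (t - a))) • ∫ s in a..(t : ℝ),
        (linearField w f C e (ext y) (lastPoint T a d s)
          - linearField w f C e (ext y') (lastPoint T a d s)) := by
      rw [intervalIntegral.integral_sub (hint y le_rfl hat) (hint y' le_rfl hat)]
      simp only [hQ, ContinuousMap.coe_mk]
      rw [← smul_sub, add_sub_add_left_eq_sub]
    have hpt : ∀ s ∈ Ioc a (t : ℝ), ‖linearField w f C e (ext y) (lastPoint T a d s)
        - linearField w f C e (ext y') (lastPoint T a d s)‖
        ≤ B * ‖C‖ * dist y y' * Real.exp (Λ * (s - a)) := fun s hs => by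
      obtain ⟨hl, hls⟩ := lastPoint_mem hT ha had hs.1.le
      set p := lastPoint T a d s
      have e2 : linearField w f C e (ext y) p - linearField w f C e (ext y') p
          = w p • C (Real.exp (Λ * (p - a)) • (y (projIcc a d had p) - y' (projIcc a d had p))) := by
        simp only [linearField, hext]
        rw [← smul_sub, add_sub_add_right_eq_sub, ← map_sub, ← smul_sub]
      rw [e2, norm_smul]
      have h3 : ‖Real.exp (Λ * (p - a)) • (y (projIcc a d had p) - y' (projIcc a d had p))‖
          ≤ Real.exp (Λ * (s - a)) * dist y y' := by
        rw [norm_smul, Real.norm_eq_abs, abs_of_pos (Real.exp_pos _), ← dist_eq_norm]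
        refine mul_le_mul (Real.exp_le_exp.2 (mul_le_mul_of_nonneg_left ?_ hΛ.le))
          (ContinuousMap.dist_apply_le_dist _) dist_nonneg (Real.exp_pos _).le
        exact sub_le_sub_right hls a
      calc ‖w p‖ * _ ≤ B * (‖C‖ * (Real.exp (Λ * (s - a)) * dist y y')) :=
            mul_le_mul (hB p hl) (C.le_opNorm_of_le h3) (norm_nonneg _) hB0
        _ = _ := by ring
    have hbd := intervalIntegral.norm_integral_le_of_norm_le hat
      (Eventually.of_forall hpt) (Continuous.intervalIntegrable
        (μ := MeasureTheory.volume) (by fun_prop) _ _)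
    rw [intervalIntegral.integral_const_mul] at hbd
    have hbd' := hbd.trans (mul_le_mul_of_nonneg_left (integral_exp_mul_sub_le hΛ a t)
      (by positivity : 0 ≤ B * ‖C‖ * dist y y'))
    rw [dist_eq_norm, e1, norm_smul, Real.norm_eq_abs, abs_of_pos (Real.exp_pos _)]
    refine (mul_le_mul_of_nonneg_left hbd' (Real.exp_pos _).le).trans ?_
    have e3 : Real.exp (-(Λ * (t - a))) * (B * ‖C‖ * dist y y' * (Real.exp (Λ * (t - a)) / Λ))
        = B * ‖C‖ / Λ * dist y y' := by
      rw [Real.exp_neg]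
      field_simp
    rw [e3]
    refine mul_le_mul_of_nonneg_right ?_ hnn
    rw [div_le_iff₀ hΛ]
    push_cast
    linarith
  set y := hcontr.fixedPoint Q with hy
  refine ⟨ext y, hextc y, fun t ht => ?_⟩
  have hfix : Q y = y := hcontr.fixedPoint_isFixedPt
  have h1 : y (projIcc a d had t) = Real.exp (-(Λ * (t - a))) •
      (z₀ + ∫ s in a..t, linearField w f C e (ext y) (lastPoint T a d s)) := by
    rw [projIcc_of_mem had ht]
    conv_lhs => rw [← hfix]
    rfl
  have h2 : ext y t = Real.exp (Λ * (t - a)) • y (projIcc a d had t) := rfl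
  rw [h2, h1, smul_smul, ← Real.exp_add, add_neg_cancel, Real.exp_zero, one_smul]

/-- The companion matrix of `∑_{k<n} α_k M_k + M_n`, as a linear map. -/
def companion (n : ℕ) (α : ℕ → ℝ) : (Fin n → ℝ) →L[ℝ] (Fin n → ℝ) :=
  ContinuousLinearMap.pi fun k =>
    if h : (k : ℕ) + 1 < n then ContinuousLinearMap.proj ⟨k + 1, h⟩
    else -∑ i : Fin n, α i • ContinuousLinearMap.proj i

/-- The initial value problem for the system `Z_k^Δ = w Z_{k+1}`, `k < n`, where
`Z_n = f - ∑_{k<n} α_k Z_k`, has a solution on `[a, d]_T`. -/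
theorem exists_hasDeltaDeriv_system (hT : IsClosed T) (ha : a ∈ T)
    (hd : d ∈ T) (had : a ≤ d) {w f : ℝ → ℝ}
    (hw : ∀ t ∈ interval T a d, sigma T t = t → ContinuousWithinAt w (interval T a d) t)
    (hf : ∀ t ∈ interval T a d, sigma T t = t → ContinuousWithinAt f (interval T a d) t)
    {B B' : ℝ} (hB : ∀ t ∈ interval T a d, |w t| ≤ B)
    (hB' : ∀ t ∈ interval T a d, |f t| ≤ B') (n : ℕ) (α z₀ : ℕ → ℝ) :
    ∃ Z : ℕ → ℝ → ℝ, (∀ k < n, Continuous (Z k)) ∧ (∀ k < n, Z k a = z₀ k) ∧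
      (∀ t, Z n t = f t - ∑ k ∈ Finset.range n, α k * Z k t) ∧
      ∀ k < n, ∀ t ∈ interval T a d, sigma T t ≤ d →
        HasDeltaDeriv T (interval T a d) (Z k) (w t * Z (k + 1) t) t := by
  set C := companion n α
  set e : Fin n → ℝ := fun k => if (k : ℕ) + 1 < n then 0 else 1 with he
  obtain ⟨Y, hYc, hY⟩ := exists_eq_integral_linearField hT ha hd had hw hf hB hB' C e
    (fun k : Fin n => z₀ k)
  have hYa : Y a = fun k : Fin n => z₀ k := by
    rw [hY a ⟨le_rfl, had⟩, intervalIntegral.integral_same, add_zero]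
  -- The component of index n is defined by the equation, so that all rows of the system read w
  -- Z_{k+1}.
  set Z : ℕ → ℝ → ℝ := fun k t => if h : k < n then Y t ⟨k, h⟩ else
    f t - ∑ i : Fin n, α i * Y t i with hZ
  have hZk : ∀ k (h : k < n) t, Z k t = Y t ⟨k, h⟩ := fun k h t => by simp only [hZ, dif_pos h]
  have hfield : ∀ k (h : k < n) t, linearField w f C e Y t ⟨k, h⟩ = w t * Z (k + 1) t := by
    intro k h t
    by_cases hk : k + 1 < n
    · simp [linearField, C, companion, he, hZ, hk]
    · simp [linearField, C, companion, he, hZ, hk]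
      left
      ring
  have hcw : ∀ t ∈ interval T a d, sigma T t = t →
      ContinuousWithinAt (linearField w f C e Y) (interval T a d) t := fun t ht hσ =>
    continuousWithinAt_linearField (hw t ht hσ) (hf t ht hσ) C e hYc
  obtain ⟨R, hR⟩ := exists_bound_linearField hB hB' C e hYc
  refine ⟨Z, fun k hk => ?_, fun k hk => ?_, fun t => ?_, fun k hk t ht hσ => ?_⟩
  · have : Z k = fun t => Y t ⟨k, hk⟩ := funext (hZk k hk)
    rw [this]
    exact (continuous_apply _).comp hYc
  · rw [hZk k hk, hYa]
  · rw [Finset.sum_range]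
    simp [hZ]
  · rw [← hfield k hk t]
    refine hasDeltaDeriv_of_eq_integral hT ha hd had (h := fun t => linearField w f C e Y t ⟨k, hk⟩)
      (fun t ht hσ => continuousWithinAt_pi.1 (hcw t ht hσ) _)
      (fun t ht => (norm_le_pi_norm _ _).trans (hR t ht)) (fun t ht => ?_) ht hσ
    rw [hZk k hk, hZk k hk, hYa, hY t ht]
    have := (ContinuousLinearMap.proj (R := ℝ) (φ := fun _ : Fin n => ℝ)
      ⟨k, hk⟩).intervalIntegral_comp_comm
      (intervalIntegrable_comp_lastPoint hT ha hd had hcw hR le_rfl ht.1)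
    simp only [ContinuousLinearMap.proj_apply] at this
    rw [this]
    rfl

end TimeScale
end

/-! ### Rd-continuity, and room at the right end of the interval -/

noncomputable section
namespace TimeScale

variable {T : Set ℝ} {a b d : ℝ} {S S' : Set ℝ} {g h : ℝ → ℝ}

theorem RdContinuousOn.mono (hg : RdContinuousOn T S g) (hS : S' ⊆ S) :
    RdContinuousOn T S' g := by
  refine ⟨fun t ht hσ => (hg.1 t (hS ht) hσ).mono hS, fun t ht hl => ?_⟩
  have hsub : S' ∩ Iio t ⊆ S ∩ Iio t := inter_subset_inter_left _ hS
  obtain ⟨l, hl'⟩ := hg.2 t (hS ht) (closure_mono hsub hl)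
  exact ⟨l, hl'.mono_left (nhdsWithin_mono t hsub)⟩

theorem RdContinuousOn.congr (hg : RdContinuousOn T S g) (hgh : ∀ t ∈ S, h t = g t) :
    RdContinuousOn T S h := by
  refine ⟨fun t ht hσ => (hg.1 t ht hσ).congr hgh (hgh t ht), fun t ht hl => ?_⟩
  obtain ⟨l, hl'⟩ := hg.2 t ht hl
  refine ⟨l, hl'.congr' ?_⟩
  filter_upwards [self_mem_nhdsWithin] with s hs
  exact (hgh s hs.1).symm

theorem RdContinuousOn.mul (hg : RdContinuousOn T S g) (hh : RdContinuousOn T S h) :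
    RdContinuousOn T S fun t => g t * h t := by
  refine ⟨fun t ht hσ => (hg.1 t ht hσ).mul (hh.1 t ht hσ), fun t ht hl => ?_⟩
  obtain ⟨l, hl'⟩ := hg.2 t ht hl
  obtain ⟨m, hm⟩ := hh.2 t ht hl
  exact ⟨l * m, hl'.mul hm⟩

theorem RdContinuousOn.sub (hg : RdContinuousOn T S g) (hh : RdContinuousOn T S h) :
    RdContinuousOn T S fun t => g t - h t := by
  refine ⟨fun t ht hσ => (hg.1 t ht hσ).sub (hh.1 t ht hσ), fun t ht hl => ?_⟩
  obtain ⟨l, hl'⟩ := hg.2 t ht hl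
  obtain ⟨m, hm⟩ := hh.2 t ht hl
  exact ⟨l - m, hl'.sub hm⟩

theorem RdContinuousOn.comp_continuous {ψ : ℝ → ℝ} (hψ : Continuous ψ)
    (hg : RdContinuousOn T S g) : RdContinuousOn T S fun t => ψ (g t) := by
  refine ⟨fun t ht hσ => hψ.continuousAt.comp_continuousWithinAt (hg.1 t ht hσ),
    fun t ht hl => ?_⟩
  obtain ⟨l, hl'⟩ := hg.2 t ht hl
  exact ⟨ψ l, (hψ.tendsto l).comp hl'⟩

theorem rdContinuousOn_of_continuous (hg : Continuous g) : RdContinuousOn T S g :=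
  ⟨fun _ _ _ => hg.continuousWithinAt, fun t _ _ =>
    ⟨g t, (hg.tendsto t).mono_left nhdsWithin_le_nhds⟩⟩

/-- An rd-continuous function on a compact set is bounded. -/
theorem RdContinuousOn.exists_bound (hg : RdContinuousOn T S g) (hS : IsCompact S)
    (hST : S ⊆ T) : ∃ B, ∀ t ∈ S, |g t| ≤ B := by
  refine hS.induction_on (p := fun U => ∃ B, ∀ t ∈ U, |g t| ≤ B) ⟨0, by simp⟩
    (fun U U' hU ⟨B, hB⟩ => ⟨B, fun t ht => hB t (hU ht)⟩)
    (fun U U' ⟨B, hB⟩ ⟨B', hB'⟩ => ⟨max B B', fun t ht => ?_⟩) fun t ht => ?_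
  · rcases ht with ht | ht
    · exact (hB t ht).trans (le_max_left _ _)
    · exact (hB' t ht).trans (le_max_right _ _)
  rcases (le_sigma T t).eq_or_lt with hσ | hσ
  · exact ⟨{s | |g s| ≤ |g t| + 1},
      (hg.1 t ht hσ.symm).abs.eventually_le_const (lt_add_one _), _, fun s hs => hs⟩
  · have hlim : ∃ l, Tendsto g (𝓝[S ∩ Iio t] t) (𝓝 l) := by
      by_cases hl : t ∈ closure (S ∩ Iio t)
      · exact hg.2 t ht hl
      · rw [mem_closure_iff_nhdsWithin_neBot, not_neBot] at hl
        exact ⟨0, hl ▸ tendsto_bot⟩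
    obtain ⟨l, hl⟩ := hlim
    have hev := eventually_nhdsWithin_iff.1 (hl.abs.eventually_le_const (lt_add_one |l|))
    refine ⟨{s | |g s| ≤ max (|l| + 1) |g t|}, ?_, _, fun s hs => hs⟩
    filter_upwards [nhdsWithin_le_nhds hev, nhdsWithin_le_nhds (Iio_mem_nhds hσ),
      self_mem_nhdsWithin] with s hs hsσ hsS
    rcases lt_trichotomy s t with h1 | h1 | h1
    · exact (hs ⟨hsS, h1⟩).trans (le_max_left _ _)
    · rw [h1]; exact le_max_right _ _
    · exact absurd (sigma_le_of_lt (hST hsS) h1) (not_le.2 hsσ)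

/-- The function `v ↦ 1 / v`, cut off at `|v| = c` to become continuous. -/
def cutoffInv (c v : ℝ) : ℝ := v / max (v ^ 2) (c ^ 2)

theorem continuous_cutoffInv {c : ℝ} (hc : 0 < c) : Continuous (cutoffInv c) := by
  refine continuous_id.div (by fun_prop) fun v => ?_
  have : 0 < max (v ^ 2) (c ^ 2) := lt_max_of_lt_right (by positivity)
  exact this.ne'

theorem cutoffInv_mul_cancel {c v : ℝ} (hc : 0 < c) (hv : c ≤ |v|) : cutoffInv c v * v = 1 := by
  have h1 : c ^ 2 ≤ v ^ 2 := by
    rw [← sq_abs v]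
    exact pow_le_pow_left₀ hc.le hv 2
  have h2 : v ≠ 0 := abs_pos.1 (hc.trans_le hv)
  rw [cutoffInv, max_eq_left h1]
  field_simp

/-- A point of T strictly beyond t makes derivatives at t unique and dependent only on values up to
that point. -/
theorem interior_point_properties {t e : ℝ} (ht : t ∈ interval T a d) (he : e ∈ T) (hte : t < e)
    (hed : e ≤ d) : sigma T t ≤ e ∧ (∀ᶠ s in 𝓝[interval T a d] t, s ≤ e) ∧
      t ∈ kappa (interval T a d) := by
  refine ⟨sigma_le_of_lt he hte, ?_, ht, Or.inl ⟨e, ⟨he, ht.2.1.trans hte.le, hed⟩, hte⟩⟩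
  filter_upwards [nhdsWithin_le_nhds (Iio_mem_nhds hte)] with s hs
  exact le_of_lt hs

/-- There are points `e 0 ≥ e 1 ≥ ⋯ ≥ e n`, with `e (k + 1) ≥ σ^{n-1-k}(b)`, such that the delta
derivatives on `[a, e (k + 1)]_T` depend only on values on `[a, e k]_T`. -/
theorem exists_nested_endpoints (hT : IsClosed T) {n : ℕ} (hn : 1 ≤ n) (hb : b ∈ T)
    (hd : d ∈ T) (hab : a ≤ b) (hbd : (sigma T)^[n] b ≤ d)
    (hκ : (sigma T)^[n - 1] b ∈ kappa (interval T a d)) {φ : ℝ → ℝ}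
    (hφ : RdContinuousOn T (interval T a d) φ) {A : ℝ} (hA : 0 < A)
    (hφA : ∀ t ∈ interval T a ((sigma T)^[n - 1] b), A ≤ |φ t|) :
    ∃ e : ℕ → ℝ, (∀ k, e k ≤ d) ∧ (∀ k < n, (sigma T)^[n - 1 - k] b ≤ e (k + 1)) ∧
      ∀ k < n, ∀ t ∈ interval T a (e (k + 1)), sigma T t ≤ e k ∧
        (∀ᶠ s in 𝓝[interval T a d] t, s ≤ e k) ∧ t ∈ kappa (interval T a d) ∧
        A / 2 ≤ |φ t| := by
  set c := (sigma T)^[n - 1] b with hc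
  have hσc : (sigma T)^[n] b = sigma T c := by
    rw [hc, ← Function.iterate_succ_apply' (sigma T), Nat.succ_eq_add_one, Nat.sub_add_cancel hn]
  have hac : a ≤ c := hab.trans (le_iterate_sigma T b _)
  have hcT : c ∈ T := iterate_sigma_mem hT hb _
  have hcd : c ≤ d := (le_sigma T c).trans (hσc ▸ hbd)
  have hcE : c ∈ interval T a d := ⟨hcT, hac, hcd⟩
  have hmono := monotone_iterate_sigma T b
  have hiter : ∀ k < n, (sigma T)^[n - 1 - k] b ≤ c := fun k _ => hmono (Nat.sub_le _ _)
  have hφA' : ∀ t ∈ interval T a c, A / 2 ≤ |φ t| := fun t ht => by linarith [hφA t ht]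
  rcases (le_sigma T c).eq_or_lt with hrd | hrs
  · rcases hcd.eq_or_lt with hcd | hcd
    -- With c = d right-dense nothing is lost; at d itself uniqueness is `hκ`.
    · refine ⟨fun _ => d, fun _ => le_rfl, fun k hk => (hiter k hk).trans hcd.le,
        fun k hk t ht => ?_⟩
      have hφt := hφA' t (hcd ▸ ht)
      rcases ht.2.2.eq_or_lt with htd | htd
      · have htc : t = c := htd.trans hcd.symm
        refine ⟨?_, eventually_mem_nhdsWithin.mono fun s hs => hs.2.2, htc ▸ hκ, hφt⟩
        rw [htc, ← hrd]
        exact hcd.le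
      · obtain ⟨h1, h2, h3⟩ := interior_point_properties ht hd htd le_rfl
        exact ⟨h1, h2, h3, hφt⟩
    -- With c < d right-dense, continuity of φ at c keeps |φ| > A / 2 slightly beyond c, and the
    -- endpoints descend strictly through points of T there.
    · have hφc : A / 2 < |φ c| := by linarith [hφA c ⟨hcT, hac, le_rfl⟩]
      have hev : ∀ᶠ s in 𝓝[interval T a d] c, A / 2 < |φ s| :=
        (hφ.1 c hcE hrd.symm).abs.eventually_const_lt hφc
      obtain ⟨v, hv, hvφ⟩ := mem_nhdsWithin_iff_exists_mem_nhds_inter.1 hev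
      obtain ⟨l, hl, hlv⟩ := exists_Ico_subset_of_mem_nhds hv ⟨d, hcd⟩
      obtain ⟨p, hp, hcp, hpl⟩ := exists_mem_Ioo_of_sigma_eq hd hcd hrd.symm (lt_min hl hcd)
      have hpl' := lt_min_iff.1 hpl
      have hstep : ∀ q : {q // q ∈ T ∧ c < q ∧ q ≤ p}, ∃ r : {q // q ∈ T ∧ c < q ∧ q ≤ p},
          r.1 < q.1 := fun ⟨q, hq, hcq, hqp⟩ => by
        obtain ⟨r, hr, hcr, hrq⟩ := exists_mem_Ioo_of_sigma_eq hd hcd hrd.symm hcq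
        exact ⟨⟨r, hr, hcr, hrq.le.trans hqp⟩, hrq⟩
      choose next hnext using hstep
      set e : ℕ → {q // q ∈ T ∧ c < q ∧ q ≤ p} := fun k => next^[k] ⟨p, hp, hcp, le_rfl⟩ with he
      have hlt : ∀ k, (e (k + 1)).1 < (e k).1 := fun k => by
        simp only [he]
        rw [Function.iterate_succ_apply']
        exact hnext _
      have hed : ∀ k, (e k).1 ≤ d := fun k => (e k).2.2.2.trans hpl'.2.le
      refine ⟨fun k => (e k).1, hed, fun k hk => (hiter k hk).trans (e (k + 1)).2.2.1.le,
        fun k hk t ht => ?_⟩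
      have htE : t ∈ interval T a d := interval_subset_interval (hed _) ht
      obtain ⟨h1, h2, h3⟩ :=
        interior_point_properties htE (e k).2.1 (ht.2.2.trans_lt (hlt k)) (hed k)
      refine ⟨h1, h2, h3, ?_⟩
      rcases le_or_gt t c with htc | htc
      · exact hφA' t ⟨ht.1, ht.2.1, htc⟩
      · refine le_of_lt (hvφ ⟨hlv ⟨htc.le, ?_⟩, htE⟩)
        exact (ht.2.2.trans (e (k + 1)).2.2.2).trans_lt hpl'.1
  -- With c right-scattered, no earlier iterate is fixed by σ, since c would equal it; so e k =
  -- σ^{n-k}(b) gives up one genuine jump per derivative.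
  · have hlt : ∀ j < n, (sigma T)^[j] b < (sigma T)^[j + 1] b := fun j hj => by
      rw [Function.iterate_succ_apply']
      refine (le_sigma T _).lt_of_ne fun h => hrs.ne ?_
      have hfix : c = (sigma T)^[j] b := by
        rw [hc, ← Nat.sub_add_cancel (Nat.le_sub_one_of_lt hj), Function.iterate_add_apply]
        exact Function.iterate_fixed h.symm _
      rw [hfix]
      exact h
    refine ⟨fun k => (sigma T)^[n - k] b, fun k => (hmono (Nat.sub_le _ _)).trans hbd,
      fun k hk => hmono (by omega), fun k hk t ht => ?_⟩
    have htlt : t < (sigma T)^[n - k] b := by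
      refine ht.2.2.trans_lt ?_
      have := hlt (n - (k + 1)) (by omega)
      rwa [show n - (k + 1) + 1 = n - k by omega] at this
    have hed : (sigma T)^[n - k] b ≤ d := (hmono (Nat.sub_le _ _)).trans hbd
    obtain ⟨h1, h2, h3⟩ := interior_point_properties ⟨ht.1, ht.2.1, htlt.le.trans hed⟩
      (iterate_sigma_mem hT hb _) htlt hed
    refine ⟨h1, h2, h3, hφA' t ⟨ht.1, ht.2.1, ht.2.2.trans ?_⟩⟩
    exact hmono (show n - (k + 1) ≤ n - 1 by omega)

end TimeScale
end

/-! ### From the system to the operators M_k, and the jumps beyond b -/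

namespace TimeScale

variable {T : Set ℝ} {a b d : ℝ} {φ : ℝ → ℝ} {n : ℕ}

/-- Uniqueness is not needed: M_{k+1} is built from the very derivative that `deltaDeriv` chose. -/
theorem hasDeltaDeriv_M {E : Set ℝ} {x : ℝ → ℝ} {k : ℕ} {t v : ℝ} (hv : v * φ t = 1)
    (h : ∃ D, HasDeltaDeriv T E (M T E φ k x) D t) :
    HasDeltaDeriv T E (M T E φ k x) (v * M T E φ (k + 1) x t) t := by
  have e : v * M T E φ (k + 1) x t = deltaDeriv T E (M T E φ k x) t := by
    rw [M, ← mul_assoc, hv, one_mul]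
  rw [e]
  exact deltaDeriv_spec h

/-- A solution of the first order system is given by the functions `M_k u`. -/
theorem M_eq_of_hasDeltaDeriv (hT : IsClosed T) {e : ℕ → ℝ} {w : ℝ → ℝ} {Z : ℕ → ℝ → ℝ}
    (hed : ∀ k, e k ≤ d)
    (he : ∀ k < n, ∀ t ∈ interval T a (e (k + 1)), sigma T t ≤ e k ∧
      (∀ᶠ s in 𝓝[interval T a d] t, s ≤ e k) ∧ t ∈ kappa (interval T a d))
    (hw : ∀ k < n, ∀ t ∈ interval T a (e (k + 1)), w t * φ t = 1)
    (hZ : ∀ k < n, ∀ t ∈ interval T a d, sigma T t ≤ d →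
      HasDeltaDeriv T (interval T a d) (Z k) (w t * Z (k + 1) t) t) :
    (∀ k ≤ n, ∀ t ∈ interval T a (e k), M T (interval T a d) φ k (Z 0) t = Z k t) ∧
    ∀ k < n, ∀ t ∈ interval T a (e (k + 1)),
      HasDeltaDeriv T (interval T a d) (M T (interval T a d) φ k (Z 0)) (w t * Z (k + 1) t) t := by
  have hderiv : ∀ k < n,
      (∀ t ∈ interval T a (e k), M T (interval T a d) φ k (Z 0) t = Z k t) →
      ∀ t ∈ interval T a (e (k + 1)), HasDeltaDeriv T (interval T a d)
        (M T (interval T a d) φ k (Z 0)) (w t * Z (k + 1) t) t := by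
    intro k hk hM t ht
    obtain ⟨h1, h2, -⟩ := he k hk t ht
    refine (hZ k hk t (interval_subset_interval (hed _) ht) (h1.trans (hed k))).congr ?_ ?_
    · filter_upwards [h2, self_mem_nhdsWithin] with s hs hsE
      exact hM s ⟨hsE.1, hsE.2.1, hs⟩
    · exact hM _ ⟨sigma_mem hT ht.1, ht.2.1.trans (le_sigma T t), h1⟩
  have hM : ∀ k ≤ n, ∀ t ∈ interval T a (e k),
      M T (interval T a d) φ k (Z 0) t = Z k t := by
    intro k
    induction k with
    | zero => exact fun _ t _ => rfl
    | succ k ih =>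
      intro hk t ht
      rw [M]
      beta_reduce
      rw [(hderiv k hk (ih (Nat.le_of_succ_le hk)) t ht).deltaDeriv_eq (he k hk t ht).2.2,
        ← mul_assoc, mul_comm (φ t), hw k hk t ht, one_mul]
  exact ⟨hM, fun k hk => hderiv k hk (hM k hk.le)⟩

/-- If the `W_k` satisfy `W_k^Δ = w W_{k+1}` at the jump points after `b`, bounds at `σ(b)`
propagate. -/
theorem abs_iterate_sigma_le {W : ℕ → ℝ → ℝ} {w : ℝ → ℝ} {B R ℓ : ℝ} (hB : 0 ≤ B) (hR : 0 ≤ R)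
    (hℓ : 0 ≤ ℓ) (h1 : ∀ k < n, |W k (sigma T b)| ≤ R)
    (hstep : ∀ j, 1 ≤ j → j < n → ∀ k < n,
      W k ((sigma T)^[j + 1] b) = W k ((sigma T)^[j] b) ∨
      (|w ((sigma T)^[j] b)| ≤ B ∧ |sigma T ((sigma T)^[j] b) - (sigma T)^[j] b| ≤ ℓ ∧
        W k ((sigma T)^[j + 1] b) = W k ((sigma T)^[j] b) + w ((sigma T)^[j] b) *
          W (k + 1) ((sigma T)^[j] b) * (sigma T ((sigma T)^[j] b) - (sigma T)^[j] b))) :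
    ∀ j, 1 ≤ j → j ≤ n → ∀ k, k + j ≤ n → |W k ((sigma T)^[j] b)| ≤ R * (1 + B * ℓ) ^ j := by
  have hone : 1 ≤ 1 + B * ℓ := by nlinarith [mul_nonneg hB hℓ]
  -- Each jump brings in W_{k+1}, so one index is lost per jump; hence the range k + j ≤ n, which
  -- never calls for W_n, not bounded beyond b.
  intro j hj
  induction j, hj using Nat.le_induction with
  | base =>
    intro _ k hk
    refine (h1 k (by omega)).trans ?_
    rw [pow_one]
    nlinarith
  | succ j hj ih =>
    intro hjn k hk
    have hk0 := ih (by omega) k (by omega)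
    have hpow : R * (1 + B * ℓ) ^ (j + 1)
        = R * (1 + B * ℓ) ^ j + B * (R * (1 + B * ℓ) ^ j) * ℓ := by ring
    have hnn : 0 ≤ R * (1 + B * ℓ) ^ j := by positivity
    rw [hpow]
    rcases hstep j hj (by omega) k (by omega) with h | ⟨hw, hμ, h⟩
    · rw [h]
      have : 0 ≤ B * (R * (1 + B * ℓ) ^ j) * ℓ := by positivity
      linarith
    · rw [h]
      refine (abs_add_le _ _).trans (add_le_add hk0 ?_)
      rw [abs_mul, abs_mul]
      exact mul_le_mul (mul_le_mul hw (ih (by omega) (k + 1) (by omega)) (abs_nonneg _) hB) hμ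
        (abs_nonneg _) (by positivity)

/-- The jump at a point `σ^j(b)`, `j ≥ 1`, of the difference of a function and a solution. -/
theorem M_sub_iterate_sigma (hT : IsClosed T) (hb : b ∈ T) (hab : a ≤ b)
    (hbd : (sigma T)^[n] b ≤ d) {w : ℝ → ℝ} {Z : ℕ → ℝ → ℝ} {x : ℝ → ℝ}
    (hw : ∀ t ∈ interval T a ((sigma T)^[n - 1] b), w t * φ t = 1)
    (hZ : ∀ k < n, ∀ t ∈ interval T a d, sigma T t ≤ d →
      HasDeltaDeriv T (interval T a d) (Z k) (w t * Z (k + 1) t) t)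
    {j k : ℕ} (hj : 1 ≤ j) (hjn : j < n) (hk : k < n) {t : ℝ} (ht : t = (sigma T)^[j] b)
    (hσ : t < sigma T t) :
    M T (interval T a d) φ k x (sigma T t) - Z k (sigma T t) =
      M T (interval T a d) φ k x t - Z k t +
        w t * (M T (interval T a d) φ (k + 1) x t - Z (k + 1) t) * (sigma T t - t) := by
  have hmono := monotone_iterate_sigma T b
  have htT : t ∈ T := ht ▸ iterate_sigma_mem hT hb j
  have hat : a ≤ t := ht ▸ hab.trans (le_iterate_sigma T b j)
  have hσd : sigma T t ≤ d := by
    rw [ht, ← Function.iterate_succ_apply' (sigma T)]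
    exact (hmono (Nat.succ_le_of_lt hjn)).trans hbd
  have htE : t ∈ interval T a d := ⟨htT, hat, hσ.le.trans hσd⟩
  obtain ⟨i, rfl⟩ := Nat.exists_eq_add_of_le' hj
  rw [Function.iterate_succ_apply'] at ht
  set p := (sigma T)^[i] b
  have hp : p < sigma T p := (le_sigma T p).lt_of_ne fun h => by
    rw [ht, ← h] at hσ
    exact hσ.ne h
  -- At an isolated right-scattered point M_k x is delta differentiable without any hypothesis on x.
  have hiso : ∀ᶠ s in 𝓝[interval T a d] t, s = t := by
    rw [ht] at hσ ⊢
    exact eventually_eq_of_isolated inter_subset_left hp hσ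
  have hwt : w t * φ t = 1 := by
    refine hw t ⟨htT, hat, ?_⟩
    rw [ht, ← Function.iterate_succ_apply' (sigma T)]
    exact hmono (show i + 1 ≤ n - 1 by omega)
  have hX := hasDeltaDeriv_M hwt
    (exists_hasDeltaDeriv_of_isolated hσ hiso (M T (interval T a d) φ k x))
  rw [(hX.sub (hZ k hk t htE hσd)).apply_sigma htE]
  ring

/-! ### The stability estimate -/

/-- Hyers-Ulam stability of the equation `∑_{k≤n} α_k M_k y = f` when `|φ|` is bounded below. The
solution is found by solving the first order system for `M_0 u, …, M_{n-1} u` forward from `a`, with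
the initial values of `x`; this requires no regressivity of the coefficients. -/
theorem hyersUlamStable_of_le_abs
    (T : Set ℝ) (hT : IsClosed T) (n : ℕ) (hn : 1 ≤ n)
    (a b d : ℝ) (ha : a ∈ T) (hb : b ∈ T) (hd : d ∈ T) (hab : a ≤ b)
    (hbd : (sigma T)^[n] b ≤ d) (hκ : (sigma T)^[n - 1] b ∈ kappa (interval T a d))
    (φ f : ℝ → ℝ) (hφ : RdContinuousOn T (interval T a d) φ)
    (hf : RdContinuousOn T (interval T a d) f) (A : ℝ) (hA : 0 < A)
    (hφA : ∀ t ∈ interval T a ((sigma T)^[n - 1] b), A ≤ |φ t|)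
    (α : ℕ → ℝ) (hαn : α n = 1) :
    HyersUlamStable T (interval T a d) a b n α φ f := by
  have hmono := monotone_iterate_sigma T b
  have hbd' : b ≤ d := (le_iterate_sigma T b n).trans hbd
  have had : a ≤ d := hab.trans hbd'
  have hA2 : 0 < A / 2 := by positivity
  obtain ⟨e, hed, heb, he⟩ := exists_nested_endpoints hT hn hb hd hab hbd hκ hφ hA hφA
  set E := interval T a d with hE
  have hEc : IsCompact E := isCompact_interval hT a d
  have hIE : interval T a b ⊆ E := interval_subset_interval hbd'
  -- The system is solved up to d, where φ may vanish; the cut-off keeps w rd-continuous on E and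
  -- equal to 1/φ wherever |φ| ≥ A / 2.
  set w : ℝ → ℝ := fun t => cutoffInv (A / 2) (φ t) with hwdef
  have hwrd : RdContinuousOn T E w := hφ.comp_continuous (continuous_cutoffInv hA2)
  have hwφ : ∀ t, A / 2 ≤ |φ t| → w t * φ t = 1 := fun t ht => cutoffInv_mul_cancel hA2 ht
  have hwc : ∀ t ∈ interval T a ((sigma T)^[n - 1] b), w t * φ t = 1 := fun t ht =>
    hwφ t (by linarith [hφA t ht])
  have hwb : ∀ t ∈ interval T a b, w t * φ t = 1 := fun t ht =>
    hwc t (interval_subset_interval (le_iterate_sigma T b _) ht)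
  obtain ⟨B, hB⟩ := hwrd.exists_bound hEc inter_subset_left
  obtain ⟨B', hB'⟩ := hf.exists_bound hEc inter_subset_left
  have hB0 : 0 < B := by
    have haI : a ∈ interval T a b := ⟨ha, le_rfl, hab⟩
    have hwa : w a ≠ 0 := left_ne_zero_of_mul (hwb a haI ▸ one_ne_zero)
    exact (abs_pos.2 hwa).trans_le (hB a (hIE haI))
  set S := ∑ k ∈ Finset.range n, |α k| with hS
  have hS0 : 0 ≤ S := Finset.sum_nonneg fun k _ => abs_nonneg _
  set L := B * (1 + S) with hL
  have hL0 : 0 ≤ L := by positivity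
  have hda : 0 ≤ d - a := sub_nonneg.2 had
  set R := 2 * B * Real.exp ((L + 1) * (d - a)) with hRdef
  have hR0 : 0 < R := by positivity
  have hone : 1 ≤ 1 + B * (d - a) := by nlinarith [mul_nonneg hB0.le hda]
  -- R is the Gronwall constant for η = Bε over length d - a; each of the at most n jumps costs a
  -- factor 1 + B(d - a).
  refine ⟨R * (1 + B * (d - a)) ^ n, by positivity, fun ε hε x hx hxf => ?_⟩
  set X : ℕ → ℝ → ℝ := fun k => M T E φ k x with hX
  obtain ⟨Z, hZc, hZa, hZn, hZd⟩ := exists_hasDeltaDeriv_system hT ha hd had hwrd.1 hf.1 hB hB'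
    n α (fun k => X k a)
  obtain ⟨hMZ, hMd⟩ := M_eq_of_hasDeltaDeriv hT hed
    (fun k hk t ht => ⟨(he k hk t ht).1, (he k hk t ht).2.1, (he k hk t ht).2.2.1⟩)
    (fun k hk t ht => hwφ t (he k hk t ht).2.2.2) hZd
  have hZrd : ∀ k ≤ n, RdContinuousOn T E (Z k) := fun k hk => by
    rcases hk.eq_or_lt with rfl | hk
    · refine (hf.sub (rdContinuousOn_of_continuous (continuous_finsetSum (Finset.range k)
        fun i hi => (hZc i (Finset.mem_range.1 hi)).const_mul (α i)))).congr fun t _ => hZn t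
    · exact rdContinuousOn_of_continuous (hZc k hk)
  refine ⟨Z 0, fun k hk => ?_, fun t ht => ?_, ?_⟩
  · have hsub : interval T a ((sigma T)^[n - 1 - k] b) ⊆ interval T a (e (k + 1)) :=
      interval_subset_interval (heb k hk)
    refine ⟨fun t ht => ⟨_, hMd k hk t (hsub ht)⟩, ?_⟩
    refine ((hwrd.mul (hZrd (k + 1) hk)).mono
      (hsub.trans (interval_subset_interval (hed _)))).congr fun t ht => ?_
    exact (hMd k hk t (hsub ht)).deltaDeriv_eq (he k hk t (hsub ht)).2.2.1
  · have hk : ∀ k ≤ n, M T E φ k (Z 0) t = Z k t := by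
      intro k hk
      refine hMZ k hk t ⟨ht.1, ht.2.1, ht.2.2.trans ?_⟩
      rcases Nat.eq_zero_or_pos k with rfl | hk0
      -- No lower bound for e 0 is given; it follows from e 0 ≥ σ(t) at t = σ^{n-1}(b) ≤ e 1.
      · have h1 := he 0 hn _ ⟨iterate_sigma_mem hT hb _, hab.trans (le_iterate_sigma T b _),
          heb 0 hn⟩
        exact (le_iterate_sigma T b _).trans ((le_sigma T _).trans h1.1)
      · have := heb (k - 1) (by omega)
        rw [Nat.sub_add_cancel hk0] at this
        exact (le_iterate_sigma T b _).trans this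
    rw [cauchyEuler, Finset.sum_range_succ, hαn, one_mul, hk n le_rfl, hZn,
      Finset.sum_congr rfl fun k hk' => by rw [hk k (Finset.mem_range.1 hk').le]]
    ring
  set W : ℕ → ℝ → ℝ := fun k t => X k t - Z k t with hW
  have hWd : ∀ k < n, ∀ t ∈ interval T a b,
      HasDeltaDeriv T E (W k) (w t * W (k + 1) t) t := fun k hk t ht => by
    have htc : sigma T t ≤ d := by
      rcases ht.2.2.eq_or_lt with rfl | htb
      · exact (hmono hn : (sigma T)^[1] t ≤ _).trans hbd
      · exact (sigma_le_of_lt hb htb).trans hbd'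
    have := (hasDeltaDeriv_M (hwb t ht) ((hx k hk).1 t ht)).sub (hZd k hk t (hIE ht) htc)
    rw [← mul_sub] at this
    exact this
  have hWn : ∀ t ∈ interval T a b, ∀ q, (∀ k < n, |W k t| ≤ q) → |W n t| ≤ ε + S * q := by
    intro t ht q hq
    have e1 : W n t = (cauchyEuler T E n α φ x t - f t)
        - ∑ k ∈ Finset.range n, α k * W k t := by
      simp only [hW, hX, cauchyEuler, mul_sub, Finset.sum_sub_distrib]
      rw [Finset.sum_range_succ, hαn, hZn]
      ring
    rw [e1]
    refine (abs_sub _ _).trans (add_le_add (hxf t ht) ?_)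
    refine (Finset.abs_sum_le_sum_abs _ _).trans ?_
    rw [hS, Finset.sum_mul]
    refine Finset.sum_le_sum fun k hk => ?_
    rw [abs_mul]
    exact mul_le_mul_of_nonneg_left (hq k (Finset.mem_range.1 hk)) (abs_nonneg _)
  have hgron := abs_le_exp_of_hasDeltaDeriv hT ha hIE (D := fun k t => w t * W (k + 1) t) hWd
    (fun k hk => by simp only [hW, hZa k hk, sub_self]) hL0 (mul_pos hB0 hε)
    (fun t ht q hq k hk => by
      have hq0 : 0 ≤ q := (abs_nonneg _).trans (hq 0 (by omega))
      -- One bound for both kinds of row: q if k + 1 < n, and ε + S q if k + 1 = n. Multiplying by B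
      -- gives L q + B ε.
      have hle : |W (k + 1) t| ≤ q + (ε + S * q) := by
        rcases Nat.lt_or_ge (k + 1) n with h | h
        · have : 0 ≤ S * q := mul_nonneg hS0 hq0
          linarith [hq (k + 1) h]
        · rw [show k + 1 = n by omega]
          linarith [hWn t ht q hq]
      rw [abs_mul]
      refine (mul_le_mul (hB t (hIE ht)) hle (abs_nonneg _) hB0.le).trans (le_of_eq ?_)
      rw [hL]
      ring)
  have hexp : ∀ t ≤ d, 2 * (B * ε) * Real.exp ((L + 1) * (t - a)) ≤ R * ε := fun t ht => by
    have : Real.exp ((L + 1) * (t - a)) ≤ Real.exp ((L + 1) * (d - a)) :=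
      Real.exp_le_exp.2 (mul_le_mul_of_nonneg_left (by linarith) (by linarith))
    calc _ ≤ 2 * (B * ε) * Real.exp ((L + 1) * (d - a)) :=
          mul_le_mul_of_nonneg_left this (by positivity)
      _ = R * ε := by rw [hRdef]; ring
  have hpow : ∀ j ≤ n, R * ε * (1 + B * (d - a)) ^ j ≤ R * (1 + B * (d - a)) ^ n * ε := by
    intro j hj
    have := mul_le_mul_of_nonneg_left (pow_le_pow_right₀ hone hj)
      (mul_pos hR0 hε).le
    linarith
  have hσb : sigma T b ≤ d := (hmono hn : (sigma T)^[1] b ≤ _).trans hbd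
  have hbI : b ∈ interval T a b := ⟨hb, hab, le_rfl⟩
  have hjump := abs_iterate_sigma_le (b := b) (W := W) (w := w) hB0.le (mul_pos hR0 hε).le hda
    (fun k hk => ((hgron b hbI k hk).2).trans (hexp _ hσb))
    (fun j hj hjn k hk => by
      rw [Function.iterate_succ_apply']
      set t := (sigma T)^[j] b with ht
      rcases (le_sigma T t).eq_or_lt with hσ | hσ
      · exact Or.inl (by rw [← hσ])
      · have hσd : sigma T t ≤ d := by
          rw [ht, ← Function.iterate_succ_apply' (sigma T)]
          exact (hmono (Nat.succ_le_of_lt hjn)).trans hbd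
        have hat : a ≤ t := hab.trans (le_iterate_sigma T b j)
        refine Or.inr ⟨hB t ⟨iterate_sigma_mem hT hb j, hat, hσ.le.trans hσd⟩, ?_,
          M_sub_iterate_sigma hT hb hab hbd hwc hZd hj hjn hk ht hσ⟩
        rw [abs_of_pos (sub_pos.2 hσ)]
        linarith)
  intro t ht
  change |W 0 t| ≤ _
  rcases le_or_gt t b with htb | htb
  · refine ((hgron t ⟨ht.1, ht.2.1, htb⟩ 0 hn).1.trans (hexp t (htb.trans hbd'))).trans ?_
    simpa using hpow 0 (Nat.zero_le n)
  · obtain ⟨j, hj1, hjn, rfl⟩ := exists_iterate_sigma_eq ht.1 htb ht.2.2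
    exact (hjump j hj1 hjn 0 (by omega)).trans (hpow j hjn)
end TimeScale

theorem theorem2p4
    -- a time scale, and the interval `[a, d]_T ⊇ [a, σⁿ(b)]_T` on which the functions are given
    (T : Set ℝ) (hT : IsClosed T)
    (n : ℕ) (hn : 1 ≤ n)
    (a b d : ℝ) (ha : a ∈ T) (hb : b ∈ T) (hd : d ∈ T) (hab : a ≤ b)
    (hbd : (TimeScale.sigma T)^[n] b ≤ d)
    -- the derivatives that the equation on `[a, b]_T` involves make sense
    (hκ : (TimeScale.sigma T)^[n - 1] b ∈ TimeScale.kappa (TimeScale.interval T a d))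
    (φ f : ℝ → ℝ)
    (hφ : TimeScale.RdContinuousOn T (TimeScale.interval T a d) φ)
    (hf : TimeScale.RdContinuousOn T (TimeScale.interval T a d) f)
    (A : ℝ) (hA : 0 < A)
    (hφA : ∀ t ∈ TimeScale.interval T a ((TimeScale.sigma T)^[n - 1] b), A ≤ |φ t|)
    (α : ℕ → ℝ) (hαn : α n = 1)
    -- the characteristic values
    (lam : Fin n → ℂ)
    (hlam : ∀ k ≤ n, (α k : ℂ) = TimeScale.elemSymm (n - k) (fun i => -lam i))
    (hreg : ∀ i : Fin n, ∀ t ∈ TimeScale.interval T a ((TimeScale.sigma T)^[n - 1] b),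
      (φ t : ℂ) + lam i * (TimeScale.mu T t : ℂ) ≠ 0) :
    TimeScale.HyersUlamStable T (TimeScale.interval T a d) a b n α φ f := by
  exact TimeScale.hyersUlamStable_of_le_abs T hT n hn a b d ha hb hd hab hbd hκ φ f hφ hf A hA hφA
    α hαn
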